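/- **Setting.** There are $N$ robots and $W$ regions. Robot $i$ has a transition system on the regions, with an initial region and a relation $\to_i$. The product transition system (PTS) has states $x=(x_1,\dots,x_N)$, and $x\to x'$ iff $x_i\to_i x_i'$ for all $i$; the label $L(x)$ is the set of atomic propositions $\pi_i^{x_i}$ ("robot $i$ is in region $x_i$"). Let $B$ be a nondeterministic Büchi automaton (NBA) with finite state set $\mathcal Q_B$ over sets of atomic propositions (it represents the task). The product Büchi automaton (PBA) has states $(x,b)$, transitions $(x,b)\to_P(x',b')$ iff $x\to x'$ and $b\xrightarrow{L(x)}b'$ in $B$, initial states $(x^0,b)$ with $x^0$ the initial PTS state and $b$ initial, and accepting states $(x,b)$ with $b$ accepting. Suppose the planning problem has a prefix-suffix solution: a finite PBA path (the prefix) from an initial state to an accepting state $q^F$, and a finite PBA path (the suffix part) that starts at $q^F$ and has a transition from its last state back to $q^F$. Let $\mathtt p=q^1,\dots,q^K$ be either its prefix part, with goal set $\mathcal X_{\rm goal}$ the set of accepting states, or its suffix part, with $\mathcal X_{\rm goal}=\{q: q\to_P q^1\}$. **Algorithm.** The tree construction starts with node set $V^0=\{q^1\}$. It first selects a target: for suffix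 parts, the NBA state of the root $q^1$; for prefix parts, a uniformly random accepting NBA state which is reachable from the NBA state of the root, and lies on a cycle, in the graph of NBA transitions enabled by a feasible symbol (a symbol that puts no robot in two regions at once); if there is none, it stops and detects nothing. At iteration $n$ it draws a node $q^{\rm rand}\in V^{n-1}$ from a distribution $f_{\rm rand}^n$, and then, from a distribution $f_{\rm new}^n(\cdot\mid q^{\rm rand})$, either a PTS state $x^{\rm new}$ with $q^{\rm rand}_{\rm PTS}\to x^{\rm new}$ or no sample. For every $b\in\mathcal Q_B$ in turn, in a fixed order, $(x^{\rm new},b)$ joins the tree iff it has a $\to_P$-predecessor in the current tree. The distributions may depend on the target, on $n$ and on all previous draws. Assume that $f_{\rm rand}^n$ is positive on $V^{n-1}$, and that whenever $q^k\in V^{n-1}$ with $k<K$, $f_{\rm new}^n(\cdot\mid q^k)$ is positive on all one-hop PTS successors of $q^k_{\rm PTS}$. **Success probabilities.** Let $X_k^n=1$ if $q^k\in V^n$, and $X_k^n=0$ otherwise. Put $k_1=1$, $Y_n=X_{k_n}^n$, and $k_{n+1}=\min(k_n+1,K)$ if $Y_n=1$, $k_{n+1}=k_n$ if $Y_n=0$.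 Let $\alpha_n(\mathtt p)$ be the smallest value of the conditional probability of $Y_n=1$ given the target and the first $n-1$ draws, over all targets and all sequences of first $n-1$ draws that have positive probability. **Theorem (Convergence rate to a feasible solution).** These minima exist and $\alpha_n(\mathtt p)\in(0,1]$ for all $n\ge1$. For every $n_{\max}>K$, the probability $\Pi_{\rm suc}(q^K)$ that the construction detects $q^K\in\mathcal X_{\rm goal}$, i.e. that $q^K$ is in the tree after $n_{\max}$ iterations, satisfies $$1\ \ge\ \Pi_{\rm suc}(q^K)\ \ge\ 1-\exp\Big(-\tfrac12\sum_{n=1}^{n_{\max}}\alpha_n(\mathtt p)+K\Big).$$ -/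

import Mathlib

namespace LTLPlanning

/-! ## Transition systems, product transition system, Büchi automaton, product automaton -/

/-- The transition system of one robot over `W` regions: its state is the region that the robot
occupies.  (Transition costs play no role for which nodes enter the tree, and are omitted.) -/
structure TransSys (W : ℕ) where
  init : Fin W
  trans : Fin W → Fin W → Prop

/-- Atomic propositions: `(i, r)` says that robot `i` is in region `r`. -/
abbrev AP (N W : ℕ) : Type := Fin N × Fin W

/-- States of the product transition system: the region of every robot. -/
abbrev PTSState (N W : ℕ) : Type := Fin N → Fin W

/-- Transition relation of the product transition system: all robots move simultaneously. -/
def ptsStep {N W : ℕ} (T : Fin N → TransSys W) (x y : PTSState N W) : Prop :=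
  ∀ i, (T i).trans (x i) (y i)

/-- The set of atomic propositions that hold at a state of the product transition system. -/
def ptsLabel {N W : ℕ} (x : PTSState N W) : Set (AP N W) := {a | x a.1 = a.2}

/-- Nondeterministic Büchi automaton over the alphabet of all sets of atomic propositions. -/
structure NBA (N W : ℕ) (Q : Type*) where
  initial : Set Q
  trans : Q → Set (AP N W) → Q → Prop
  accepting : Set Q

/-- States of the product Büchi automaton (PBA). -/
abbrev PBAState (N W : ℕ) (Q : Type*) : Type _ := PTSState N W × Q

variable {N W : ℕ} {Q : Type*}

/-- Transition relation of the PBA. -/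
def pbaStep (T : Fin N → TransSys W) (B : NBA N W Q) (s s' : PBAState N W Q) : Prop :=
  ptsStep T s.1 s'.1 ∧ B.trans s.2 (ptsLabel s.1) s'.2

/-- Initial states of the PBA. -/
def pbaInitial (T : Fin N → TransSys W) (B : NBA N W Q) : Set (PBAState N W Q) :=
  {s | (s.1 = fun i => (T i).init) ∧ s.2 ∈ B.initial}

/-- Accepting states of the PBA. -/
def pbaAccepting (B : NBA N W Q) : Set (PBAState N W Q) := {s | s.2 ∈ B.accepting}

/-- A symbol is feasible if it requires no robot to be in two different regions at once. -/
def FeasibleSymbol (σ : Set (AP N W)) : Prop :=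
  ∀ (i : Fin N) (r r' : Fin W), (i, r) ∈ σ → (i, r') ∈ σ → r = r'

/-- Edges of the pruned automaton graph: transitions enabled by some feasible symbol. -/
def feasEdge (B : NBA N W Q) (b b' : Q) : Prop :=
  ∃ σ : Set (AP N W), FeasibleSymbol σ ∧ B.trans b σ b'

/-! ## Solutions in prefix-suffix form -/

/-- The two uses of the tree construction: for prefix parts and for suffix parts. -/
inductive Phase
  | pre
  | suf

/-- A plan in prefix-suffix form, in the PBA.  Paths are indexed from `1`; the values of
`path ph` outside `1, …, len ph` are irrelevant.  The prefix part leads from an initial to an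
accepting state; the suffix part starts at that accepting state, and a transition leads from its
last state back to its first one. -/
structure PrefixSuffixPlan (T : Fin N → TransSys W) (B : NBA N W Q) where
  path : Phase → ℕ → PBAState N W Q
  len : Phase → ℕ
  len_pos : ∀ ph, 1 ≤ len ph
  step : ∀ ph k, 1 ≤ k → k < len ph → pbaStep T B (path ph k) (path ph (k + 1))
  pre_start : path Phase.pre 1 ∈ pbaInitial T B
  pre_end : path Phase.pre (len Phase.pre) ∈ pbaAccepting B
  suf_start : path Phase.suf 1 = path Phase.pre (len Phase.pre)
  suf_close : pbaStep T B (path Phase.suf (len Phase.suf)) (path Phase.suf 1)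

/-- Goal region of the tree with the given root. -/
def goalSet (T : Fin N → TransSys W) (B : NBA N W Q) (root : PBAState N W Q) :
    Phase → Set (PBAState N W Q)
  | Phase.pre => pbaAccepting B
  | Phase.suf => {s | pbaStep T B s root}

/-! ## The tree construction -/

open Classical in
/-- The automaton states towards which the sampling may be biased.  For prefix parts: the
accepting states reachable from the root in the pruned automaton graph that lie on a cycle of
it.  For suffix parts: the automaton part of the root. -/
noncomputable def targets [Fintype Q] (B : NBA N W Q) (root : PBAState N W Q) :
    Phase → Finset Q
  | Phase.pre => Finset.univ.filter fun b =>
      b ∈ B.accepting ∧ Relation.TransGen (feasEdge B) root.2 b ∧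
        Relation.TransGen (feasEdge B) b b
  | Phase.suf => {root.2}

/-- What one call of the sampling function draws: the selected tree node, and the new state of
the product transition system (`none` if the call generates no sample). -/
abbrev Draw (N W : ℕ) (Q : Type*) : Type _ := PBAState N W Q × Option (PTSState N W)

/-- The draws of all iterations so far, the latest one first. -/
abbrev History (N W : ℕ) (Q : Type*) : Type _ := List (Draw N W Q)

open Classical in
/-- Extension step on the node set: the candidate `s` joins the tree if and only if it has a
candidate parent in the tree (nothing changes if it is already there). -/
noncomputable def tryAdd (T : Fin N → TransSys W) (B : NBA N W Q)
    (V : Finset (PBAState N W Q)) (s : PBAState N W Q) : Finset (PBAState N W Q) :=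
  if ∃ s' ∈ V, pbaStep T B s' s then insert s V else V

/-- The inner loop of an iteration: for all automaton states `b`, in the order of the enumeration
`e`, try to add `(x, b)`. -/
noncomputable def addAll [Fintype Q] (T : Fin N → TransSys W) (B : NBA N W Q)
    (e : Fin (Fintype.card Q) ≃ Q) (V : Finset (PBAState N W Q)) (x : PTSState N W) :
    Finset (PBAState N W Q) :=
  (List.ofFn e).foldl (fun V' b => tryAdd T B V' (x, b)) V

/-- The node set of the tree after the draws of a history.  (Choosing among several parents and
rewiring only affect the edges and costs of the tree, not its nodes.) -/
noncomputable def nodes [Fintype Q] (T : Fin N → TransSys W) (B : NBA N W Q)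
    (e : Fin (Fintype.card Q) ≃ Q) (root : PBAState N W Q) :
    History N W Q → Finset (PBAState N W Q)
  | [] => {root}
  | (_, none) :: h => nodes T B e root h
  | (_, some x) :: h => addAll T B e (nodes T B e root h) x

/-- A sampling function: given the bias target and the history, `frand` is the law of the selected
tree node, and `fnew` the law of the new state, given the selected node.  Both may change with
the iteration number (the length of the history plus one) and with everything that has been
drawn before.  Nodes are selected from the tree with positive probability each, and new
states are reachable in one hop from the selected node. -/
structure Sampler [Fintype Q] (T : Fin N → TransSys W) (B : NBA N W Q)
    (e : Fin (Fintype.card Q) ≃ Q) (root : PBAState N W Q) where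
  frand : Q → History N W Q → PMF (PBAState N W Q)
  fnew : Q → History N W Q → PBAState N W Q → PMF (Option (PTSState N W))
  frand_support : ∀ b h s, s ∈ (frand b h).support ↔ s ∈ nodes T B e root h
  fnew_support : ∀ b h s x, some x ∈ (fnew b h s).support → ptsStep T s.1 x

section Algorithm

variable [Fintype Q] {T : Fin N → TransSys W} {B : NBA N W Q} {e : Fin (Fintype.card Q) ≃ Q}
  {root : PBAState N W Q}

/-- The law of the draw of the next iteration. -/
noncomputable def Sampler.draw (S : Sampler T B e root) (b : Q) (h : History N W Q) :
    PMF (Draw N W Q) :=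
  (S.frand b h).bind fun s => (S.fnew b h s).map fun x => (s, x)

/-- The law of the history of the first `n` iterations. -/
noncomputable def Sampler.run (S : Sampler T B e root) (b : Q) : ℕ → PMF (History N W Q)
  | 0 => PMF.pure []
  | n + 1 => (S.run b n).bind fun h => (S.draw b h).map fun d => d :: h

open Classical in
/-- The tree construction with `n` iterations: the law of its output, the set of goal states among
the nodes of the final tree.  The bias target is selected at random among the possible ones; if
there is none, the construction stops and returns the empty set. -/
noncomputable def Sampler.constructTree (S : Sampler T B e root) (ph : Phase) (n : ℕ) :
    PMF (Finset (PBAState N W Q)) :=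
  if hne : (targets B root ph).Nonempty then
    (PMF.uniformOfFinset (targets B root ph) hne).bind fun b =>
      (S.run b n).map fun h =>
        (nodes T B e root h).filter fun s => s ∈ goalSet T B root ph
  else PMF.pure ∅

/-- The probability that the tree construction detects the goal state `s` within `n`
iterations. -/
noncomputable def Sampler.detectProb (S : Sampler T B e root) (ph : Phase) (n : ℕ)
    (s : PBAState N W Q) : ℝ :=
  ((S.constructTree ph n).toOuterMeasure {Z | s ∈ Z}).toReal

open Classical in
/-- The index `k` of the path state `q k` that the next iteration is waiting for: it starts at
`1`, and after every iteration at whose end `q k` is in the tree it is increased by one, up to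
the number `K` of states of the path. -/
noncomputable def stage (T : Fin N → TransSys W) (B : NBA N W Q) (e : Fin (Fintype.card Q) ≃ Q)
    (root : PBAState N W Q) (q : ℕ → PBAState N W Q) (K : ℕ) : History N W Q → ℕ
  | [] => 1
  | d :: h =>
    if q (stage T B e root q K h) ∈ nodes T B e root (d :: h) then
      min (stage T B e root q K h + 1) K
    else stage T B e root q K h

/-- The conditional probability, given the bias target and the history, that the next iteration is
a success: that at its end the path state it is waiting for is in the tree. -/
noncomputable def Sampler.successProb (S : Sampler T B e root) (q : ℕ → PBAState N W Q) (K : ℕ)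
    (b : Q) (h : History N W Q) : ℝ :=
  ((S.draw b h).toOuterMeasure
    {d | q (stage T B e root q K h) ∈ nodes T B e root (d :: h)}).toReal

/-- The values that the success probability of iteration `n` (`n ≥ 1`) can take, over all bias
targets and all histories of the first `n - 1` iterations that have positive probability. -/
def Sampler.successValues (S : Sampler T B e root) (ph : Phase) (q : ℕ → PBAState N W Q) (K : ℕ)
    (n : ℕ) : Set ℝ :=
  {r | ∃ b ∈ targets B root ph, ∃ h ∈ (S.run b (n - 1)).support, r = S.successProb q K b h}

end Algorithm

end LTLPlanning

namespace LTLPlanning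

/-! This is a Chernoff-type argument that needs no independence. Let M be the number of successful
iterations. Conditionally on the past, iteration n succeeds with probability at least α n, so it
multiplies the expectation of exp(-M) by at most 1 - α n / 2 ≤ exp(-α n / 2). Hence E exp(-M) ≤
exp(-∑ α n / 2) (`Sampler.tsum_run_mul_exp_le`). If `q K` is missing from the tree, every success
has advanced the stage, so M ≤ K (`successCount_le_of_notMem`). Markov's inequality then bounds the
failure probability by exp(-∑ α n / 2 + K), for each target separately.

The minima exist because draws range over a finite type. They are positive because the predecessor
of the awaited state is already in the tree, and the right one-hop move has positive probability
(`Sampler.successProb_pos`). -/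

theorem targets_nonempty {N W : ℕ} {Q : Type*} [Fintype Q] {T : Fin N → TransSys W}
    {B : NBA N W Q} (plan : PrefixSuffixPlan T B) (ph : Phase) :
    (targets B (plan.path ph 1) ph).Nonempty := by
  -- The label of a PTS state is a feasible symbol, so PBA paths project to the pruned automaton
  -- graph.
  have hedge : ∀ {s s' : PBAState N W Q}, pbaStep T B s s' → feasEdge B s.2 s'.2 := by
    rintro s s' ⟨-, h⟩
    exact ⟨_, fun i r r' h₁ h₂ => Eq.trans (Eq.symm h₁) h₂, h⟩
  have hpath : ∀ ph k, 1 ≤ k → k ≤ plan.len ph →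
      Relation.ReflTransGen (feasEdge B) (plan.path ph 1).2 (plan.path ph k).2 := by
    intro ph k hk
    induction k, hk using Nat.le_induction with
    | base => exact fun _ => .refl
    | succ k hk ih => exact fun hle => (ih (by omega)).tail (hedge (plan.step ph k hk (by omega)))
  have hcycle : Relation.TransGen (feasEdge B) (plan.path .suf 1).2 (plan.path .suf 1).2 :=
    Relation.TransGen.tail' (hpath .suf _ (plan.len_pos _) le_rfl) (hedge plan.suf_close)
  cases ph with
  | suf => exact ⟨_, Finset.mem_singleton_self _⟩
  | pre =>
    rw [plan.suf_start] at hcycle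
    refine ⟨(plan.path .pre (plan.len .pre)).2, ?_⟩
    simp only [targets, Finset.mem_filter, Finset.mem_univ, true_and]
    exact ⟨plan.pre_end,
      Relation.TransGen.trans_right (hpath .pre _ (plan.len_pos _) le_rfl) hcycle, hcycle⟩

theorem path_len_mem_goalSet {N W : ℕ} {Q : Type*} {T : Fin N → TransSys W}
    {B : NBA N W Q} (plan : PrefixSuffixPlan T B) (ph : Phase) :
    plan.path ph (plan.len ph) ∈ goalSet T B (plan.path ph 1) ph := by
  cases ph with
  | pre => exact plan.pre_end
  | suf => exact plan.suf_close

/-! ### Deterministic facts: growth of the tree, stages and success counts. -/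

section Nodes

variable {N W : ℕ} {Q : Type*} {T : Fin N → TransSys W} {B : NBA N W Q}

open Classical in
theorem subset_tryAdd (V : Finset (PBAState N W Q)) (s : PBAState N W Q) :
    V ⊆ tryAdd T B V s := by
  unfold tryAdd
  split_ifs
  · exact Finset.subset_insert _ _
  · exact Finset.Subset.refl _

theorem subset_foldl_tryAdd (x : PTSState N W) (l : List Q) (V : Finset (PBAState N W Q)) :
    V ⊆ l.foldl (fun V' b => tryAdd T B V' (x, b)) V := by
  induction l generalizing V with
  | nil => exact Finset.Subset.refl _
  | cons b l ih => exact (subset_tryAdd V _).trans (ih _)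

open Classical in
-- The order of the list is immaterial: the tree only grows, so the parent is still present when `b`
-- is processed.
theorem mem_foldl_tryAdd {x : PTSState N W} {l : List Q} {b : Q} (hb : b ∈ l)
    {V : Finset (PBAState N W Q)} {s : PBAState N W Q} (hs : s ∈ V)
    (hstep : pbaStep T B s (x, b)) :
    (x, b) ∈ l.foldl (fun V' b => tryAdd T B V' (x, b)) V := by
  induction l generalizing V with
  | nil => simp at hb
  | cons c l ih =>
    rcases List.mem_cons.1 hb with rfl | hb
    · refine subset_foldl_tryAdd x l _ ?_
      change (x, b) ∈ tryAdd T B V (x, b)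
      unfold tryAdd
      rw [if_pos ⟨s, hs, hstep⟩]
      exact Finset.mem_insert_self _ _
    · exact ih hb (subset_tryAdd V _ hs)

variable [Fintype Q] {e : Fin (Fintype.card Q) ≃ Q} {root : PBAState N W Q}

theorem nodes_subset_nodes_cons (d : Draw N W Q) (h : History N W Q) :
    nodes T B e root h ⊆ nodes T B e root (d :: h) := by
  obtain ⟨s, _ | x⟩ := d
  · exact Finset.Subset.refl _
  · exact subset_foldl_tryAdd x _ _

theorem mem_nodes_cons_of_step {s s' : PBAState N W Q} {h : History N W Q}
    (hs : s ∈ nodes T B e root h) (hstep : pbaStep T B s s') (c : PBAState N W Q) :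
    s' ∈ nodes T B e root ((c, some s'.1) :: h) :=
  mem_foldl_tryAdd (b := s'.2) (List.mem_ofFn.2 ⟨e.symm s'.2, by simp⟩) hs hstep

theorem root_mem_nodes (h : History N W Q) : root ∈ nodes T B e root h := by
  induction h with
  | nil => exact Finset.mem_singleton_self _
  | cons d h ih => exact nodes_subset_nodes_cons d h ih

variable {q : ℕ → PBAState N W Q} {K : ℕ}

theorem one_le_stage (hK : 1 ≤ K) (h : History N W Q) : 1 ≤ stage T B e root q K h := by
  induction h with
  | nil => exact le_rfl
  | cons d h ih => rw [stage]; split_ifs <;> omega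

theorem stage_le (hK : 1 ≤ K) (h : History N W Q) : stage T B e root q K h ≤ K := by
  induction h with
  | nil => exact hK
  | cons d h ih => rw [stage]; split_ifs <;> omega

/-- The stage moves past `k` only once `q k` is in the tree, and nodes never leave. -/
theorem mem_nodes_of_lt_stage {h : History N W Q} {k : ℕ} (hk : 1 ≤ k)
    (hstage : k < stage T B e root q K h) : q k ∈ nodes T B e root h := by
  induction h with
  | nil => simp only [stage] at hstage; omega
  | cons d h ih =>
    rw [stage] at hstage
    split_ifs at hstage with hmem
    · rcases Nat.lt_or_ge k (stage T B e root q K h) with hlt | hge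
      · exact nodes_subset_nodes_cons d h (ih hlt)
      · have : k = stage T B e root q K h := by omega
        rwa [this]
    · exact nodes_subset_nodes_cons d h (ih hstage)

open Classical in
/-- The number of successful iterations of a history. -/
noncomputable def successCount (T : Fin N → TransSys W) (B : NBA N W Q)
    (e : Fin (Fintype.card Q) ≃ Q) (root : PBAState N W Q) (q : ℕ → PBAState N W Q) (K : ℕ) :
    History N W Q → ℕ
  | [] => 0
  | d :: h =>
    if q (stage T B e root q K h) ∈ nodes T B e root (d :: h) then
      successCount T B e root q K h + 1
    else successCount T B e root q K h

/-- Count and stage grow together until the cap at `K` binds; a success at stage `K` puts `q K`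
itself in the tree. -/
theorem successCount_add_one_eq_stage_or_mem_nodes (hK : 1 ≤ K) (h : History N W Q) :
    successCount T B e root q K h + 1 = stage T B e root q K h ∨
      q K ∈ nodes T B e root h := by
  induction h with
  | nil => exact .inl rfl
  | cons d h ih =>
    rcases ih with ih | ih
    · rw [stage, successCount]
      split_ifs with hmem
      · have hle := stage_le (T := T) (B := B) (e := e) (root := root) (q := q) hK h
        rcases hle.lt_or_eq with hlt | heq
        · left; omega
        · right; rwa [heq] at hmem
      · exact .inl ih
    · exact .inr (nodes_subset_nodes_cons d h ih)

theorem successCount_le_of_notMem (hK : 1 ≤ K) {h : History N W Q}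
    (hmem : q K ∉ nodes T B e root h) : successCount T B e root q K h ≤ K := by
  have hle := stage_le (T := T) (B := B) (e := e) (root := root) (q := q) hK h
  have := (successCount_add_one_eq_stage_or_mem_nodes hK h).resolve_right hmem
  omega

end Nodes

/-! ### Expectations under a `PMF` and the one-step exponential bound. -/

section PMF

open ENNReal

variable {α β : Type*}

theorem _root_.PMF.tsum_bind_mul (p : PMF α) (f : α → PMF β) (g : β → ℝ≥0∞) :
    ∑' b, p.bind f b * g b = ∑' a, p a * ∑' b, f a b * g b := by
  simp_rw [PMF.bind_apply, ← ENNReal.tsum_mul_right, ← ENNReal.tsum_mul_left, mul_assoc]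
  exact ENNReal.tsum_comm

theorem _root_.PMF.tsum_map_mul (p : PMF α) (f : α → β) (g : β → ℝ≥0∞) :
    ∑' b, p.map f b * g b = ∑' a, p a * g (f a) := by
  rw [PMF.map, PMF.tsum_bind_mul]
  simp

theorem _root_.PMF.toOuterMeasure_add_compl (p : PMF α) (A : Set α) :
    p.toOuterMeasure A + p.toOuterMeasure Aᶜ = 1 := by
  rw [PMF.toOuterMeasure_apply, PMF.toOuterMeasure_apply, ← ENNReal.tsum_add, ← p.tsum_coe]
  exact tsum_congr fun a => Set.indicator_self_add_compl_apply A p a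

theorem _root_.PMF.toOuterMeasure_apply_le_one (p : PMF α) (A : Set α) :
    p.toOuterMeasure A ≤ 1 :=
  (p.toOuterMeasure_add_compl A).le.trans' le_self_add

open Classical in
theorem _root_.PMF.tsum_mul_ite_exp_le (p : PMF α) (A : Set α) (a : ℝ)
    (ha : a ≤ (p.toOuterMeasure A).toReal) :
    ∑' d, p d * (if d ∈ A then ENNReal.ofReal (Real.exp (-1)) else 1) ≤
      ENNReal.ofReal (Real.exp (-a / 2)) := by
  have hsplit : ∑' d, p d * (if d ∈ A then ENNReal.ofReal (Real.exp (-1)) else 1) =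
      p.toOuterMeasure A * ENNReal.ofReal (Real.exp (-1)) + p.toOuterMeasure Aᶜ := by
    rw [PMF.toOuterMeasure_apply, PMF.toOuterMeasure_apply, ← ENNReal.tsum_mul_right,
      ← ENNReal.tsum_add]
    refine tsum_congr fun d => ?_
    by_cases hd : d ∈ A <;> simp [hd]
  have hA := p.toOuterMeasure_apply_le_one A
  have hAtop : p.toOuterMeasure A ≠ ∞ := ne_top_of_le_ne_top one_ne_top hA
  have hctop : p.toOuterMeasure Aᶜ ≠ ∞ :=
    ne_top_of_le_ne_top one_ne_top (p.toOuterMeasure_apply_le_one Aᶜ)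
  have hadd := congrArg ENNReal.toReal (p.toOuterMeasure_add_compl A)
  rw [ENNReal.toReal_add hAtop hctop, ENNReal.toReal_one] at hadd
  rw [hsplit]
  refine (ENNReal.le_ofReal_iff_toReal_le
    (ENNReal.add_ne_top.2 ⟨ENNReal.mul_ne_top hAtop ofReal_ne_top, hctop⟩)
    (Real.exp_pos _).le).2 ?_
  rw [ENNReal.toReal_add (ENNReal.mul_ne_top hAtop ofReal_ne_top) hctop, ENNReal.toReal_mul,
    ENNReal.toReal_ofReal (Real.exp_pos _).le]
  have hexp : Real.exp (-1) ≤ 1 / 2 := by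
    rw [Real.exp_neg, inv_eq_one_div]
    exact one_div_le_one_div_of_le two_pos (by linarith [Real.add_one_le_exp 1])
  have hmul := mul_le_mul_of_nonneg_left hexp
    (ENNReal.toReal_nonneg (a := p.toOuterMeasure A))
  -- With p the probability of `A`: p exp(-1) + (1 - p) ≤ 1 - p/2 ≤ 1 - a/2 ≤ exp(-a/2).
  linarith [Real.add_one_le_exp (-a / 2)]

end PMF

/-! ### Success probabilities, the exponential moment and detection. -/

section Sampler

open ENNReal

variable {N W : ℕ} {Q : Type*} [Fintype Q] {T : Fin N → TransSys W} {B : NBA N W Q}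
  {e : Fin (Fintype.card Q) ≃ Q} {root : PBAState N W Q}

theorem Sampler.mem_support_draw (S : Sampler T B e root) (b : Q) (h : History N W Q)
    (d : Draw N W Q) :
    d ∈ (S.draw b h).support ↔ d.1 ∈ nodes T B e root h ∧ d.2 ∈ (S.fnew b h d.1).support := by
  rw [Sampler.draw, PMF.mem_support_bind_iff]
  simp only [PMF.mem_support_map_iff, S.frand_support]
  constructor
  · rintro ⟨s, hs, x, hx, rfl⟩
    exact ⟨hs, hx⟩
  · rintro ⟨hs, hx⟩
    exact ⟨d.1, hs, d.2, hx, rfl⟩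

theorem Sampler.length_eq_of_mem_support_run (S : Sampler T B e root) (b : Q) (n : ℕ)
    {h : History N W Q} (hh : h ∈ (S.run b n).support) : h.length = n := by
  induction n generalizing h with
  | zero =>
    rw [Sampler.run, PMF.mem_support_pure_iff] at hh
    rw [hh, List.length_nil]
  | succ n ih =>
    rw [Sampler.run, PMF.mem_support_bind_iff] at hh
    obtain ⟨h', hh', hd⟩ := hh
    obtain ⟨d, -, rfl⟩ := (PMF.mem_support_map_iff _ _ _).1 hd
    rw [List.length_cons, ih hh']

variable {q : ℕ → PBAState N W Q} {K : ℕ}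

theorem Sampler.finite_successValues (S : Sampler T B e root) (ph : Phase) (n : ℕ) :
    (S.successValues ph q K n).Finite := by
  refine (((targets B root ph).finite_toSet.prod
    (List.finite_length_eq (Draw N W Q) (n - 1))).image
    fun z => S.successProb q K z.1 z.2).subset ?_
  rintro r ⟨b, hb, h, hh, rfl⟩
  exact ⟨(b, h), ⟨hb, S.length_eq_of_mem_support_run b _ hh⟩, rfl⟩

theorem Sampler.successProb_le_one (S : Sampler T B e root) (b : Q) (h : History N W Q) :
    S.successProb q K b h ≤ 1 :=
  ENNReal.toReal_le_of_le_ofReal zero_le_one (by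
    rw [ENNReal.ofReal_one]
    exact PMF.toOuterMeasure_apply_le_one _ _)

theorem Sampler.successProb_pos (S : Sampler T B e root) (hK : 1 ≤ K) (hroot : q 1 = root)
    (hstep : ∀ k, 1 ≤ k → k < K → pbaStep T B (q k) (q (k + 1))) (b : Q) (h : History N W Q)
    (hnew : ∀ k, 1 ≤ k → k < K → q k ∈ nodes T B e root h →
      ∀ x, ptsStep T (q k).1 x → some x ∈ (S.fnew b h (q k)).support) :
    0 < S.successProb q K b h := by
  suffices hd : ∃ d ∈ (S.draw b h).support,
      q (stage T B e root q K h) ∈ nodes T B e root (d :: h) by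
    obtain ⟨d, hd, hmem⟩ := hd
    refine ENNReal.toReal_pos (fun h0 => ?_)
      (ne_top_of_le_ne_top one_ne_top (PMF.toOuterMeasure_apply_le_one _ _))
    exact Set.disjoint_left.1 ((PMF.toOuterMeasure_apply_eq_zero_iff _ _).1 h0) hd hmem
  have hpos := one_le_stage (T := T) (B := B) (e := e) (root := root) (q := q) hK h
  have hle := stage_le (T := T) (B := B) (e := e) (root := root) (q := q) hK h
  -- At stage 1 the awaited state is the root, so any draw succeeds; later, the preceding path state
  -- is in the tree and can be selected.
  rcases hpos.eq_or_lt with hone | hlt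
  · obtain ⟨d, hd⟩ := (S.draw b h).support_nonempty
    exact ⟨d, hd, by rw [← hone, hroot]; exact root_mem_nodes _⟩
  · obtain ⟨k, hk⟩ : ∃ k, stage T B e root q K h = k + 1 := ⟨_, (Nat.sub_add_cancel hpos).symm⟩
    rw [hk] at hlt hle ⊢
    have hmem : q k ∈ nodes T B e root h :=
      mem_nodes_of_lt_stage (K := K) (by omega) (by omega)
    have hs := hstep k (by omega) hle
    exact ⟨(q k, some (q (k + 1)).1), (S.mem_support_draw _ _ _).2
      ⟨hmem, hnew k (by omega) hle hmem _ hs.1⟩, mem_nodes_cons_of_step hmem hs _⟩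

/-- Induction on `n`, conditioning on the history before the last draw. Null histories, where `hα`
says nothing, contribute zero. -/
theorem Sampler.tsum_run_mul_exp_le (S : Sampler T B e root) (b : Q) {α : ℕ → ℝ}
    (hα : ∀ n, ∀ h ∈ (S.run b n).support, α (n + 1) ≤ S.successProb q K b h) (n : ℕ) :
    ∑' h, S.run b n h * ENNReal.ofReal (Real.exp (-(successCount T B e root q K h : ℝ))) ≤
      ENNReal.ofReal (Real.exp (-(∑ m ∈ Finset.Icc 1 n, α m) / 2)) := by
  induction n with
  | zero => simp [Sampler.run, successCount]
  | succ n ih =>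
    rw [Sampler.run, PMF.tsum_bind_mul, Finset.sum_Icc_succ_top (by omega), neg_add, add_div,
      Real.exp_add, ENNReal.ofReal_mul (Real.exp_pos _).le]
    refine le_trans ?_ (mul_le_mul_left ih _)
    rw [← ENNReal.tsum_mul_right]
    refine ENNReal.tsum_le_tsum fun h => ?_
    by_cases hh : h ∈ (S.run b n).support
    · rw [PMF.tsum_map_mul, mul_assoc]
      refine mul_le_mul_right (le_trans (le_of_eq ?_) (mul_le_mul_right
        (PMF.tsum_mul_ite_exp_le (S.draw b h) _ _ (hα n h hh)) _)) _
      rw [← ENNReal.tsum_mul_left]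
      refine tsum_congr fun d => ?_
      rw [successCount, Set.mem_ofPred_eq]
      split_ifs
      · rw [Nat.cast_succ, neg_add, Real.exp_add, ENNReal.ofReal_mul (Real.exp_pos _).le]
        ring
      · ring
    · simp [(PMF.apply_eq_zero_iff _ _).2 hh]

/-- Markov's inequality: on failure, exp(K - M) ≥ 1. -/
theorem Sampler.le_toOuterMeasure_run (S : Sampler T B e root) (hK : 1 ≤ K) (b : Q) {α : ℕ → ℝ}
    (hα : ∀ n, ∀ h ∈ (S.run b n).support, α (n + 1) ≤ S.successProb q K b h) (n : ℕ) :
    ENNReal.ofReal (1 - Real.exp (-(∑ m ∈ Finset.Icc 1 n, α m) / 2 + K)) ≤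
      (S.run b n).toOuterMeasure {h | q K ∈ nodes T B e root h} := by
  have hcompl : (S.run b n).toOuterMeasure {h | q K ∈ nodes T B e root h}ᶜ ≤
      ENNReal.ofReal (Real.exp (-(∑ m ∈ Finset.Icc 1 n, α m) / 2 + K)) := by
    rw [Real.exp_add, ENNReal.ofReal_mul (Real.exp_pos _).le]
    refine le_trans ?_ (mul_le_mul_left (S.tsum_run_mul_exp_le (q := q) (K := K) b hα n) _)
    rw [PMF.toOuterMeasure_apply, ← ENNReal.tsum_mul_right]
    refine ENNReal.tsum_le_tsum fun h => Set.indicator_apply_le' (fun hh => ?_) fun _ => zero_le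
    have hle : (successCount T B e root q K h : ℝ) ≤ K := by
      exact_mod_cast successCount_le_of_notMem hK hh
    rw [mul_assoc, ← ENNReal.ofReal_mul (Real.exp_pos _).le, ← Real.exp_add]
    refine le_mul_of_one_le_right zero_le (ENNReal.one_le_ofReal.2 (Real.one_le_exp ?_))
    linarith
  rw [ENNReal.ofReal_sub _ (Real.exp_pos _).le, ENNReal.ofReal_one, tsub_le_iff_right,
    ← PMF.toOuterMeasure_add_compl (S.run b n) {h | q K ∈ nodes T B e root h}]
  gcongr

theorem Sampler.detectProb_le_one (S : Sampler T B e root) (ph : Phase) (n : ℕ)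
    (s : PBAState N W Q) : S.detectProb ph n s ≤ 1 :=
  ENNReal.toReal_le_of_le_ofReal zero_le_one (by
    rw [ENNReal.ofReal_one]
    exact PMF.toOuterMeasure_apply_le_one _ _)

/-- The detection probability is an average over targets, so a bound uniform in the target survives.
-/
theorem Sampler.le_detectProb (S : Sampler T B e root) {ph : Phase}
    (hne : (targets B root ph).Nonempty) {s : PBAState N W Q} (hs : s ∈ goalSet T B root ph)
    {n : ℕ} {c : ℝ} (hc : ∀ b ∈ targets B root ph,
      ENNReal.ofReal c ≤ (S.run b n).toOuterMeasure {h | s ∈ nodes T B e root h}) :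
    c ≤ S.detectProb ph n s := by
  rw [Sampler.detectProb, ← ENNReal.ofReal_le_iff_le_toReal
    (ne_top_of_le_ne_top one_ne_top (PMF.toOuterMeasure_apply_le_one _ _)),
    Sampler.constructTree, dif_pos hne, PMF.toOuterMeasure_bind_apply]
  conv_lhs => rw [← one_mul (ENNReal.ofReal c),
    ← (PMF.uniformOfFinset (targets B root ph) hne).tsum_coe, ← ENNReal.tsum_mul_right]
  refine ENNReal.tsum_le_tsum fun b => ?_
  by_cases hb : b ∈ targets B root ph
  · rw [PMF.toOuterMeasure_map_apply]
    refine mul_le_mul_right ((hc b hb).trans (le_of_eq (congrArg _ ?_))) _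
    ext h
    simp [hs]
  · simp [PMF.uniformOfFinset_apply_of_notMem hne hb]

end Sampler

end LTLPlanning

theorem mainTheorem1 {N W : ℕ} {Q : Type*} [Fintype Q]
    (T : Fin N → LTLPlanning.TransSys W) (B : LTLPlanning.NBA N W Q)
    (e : Fin (Fintype.card Q) ≃ Q)
    (plan : LTLPlanning.PrefixSuffixPlan T B) (ph : LTLPlanning.Phase)
    (S : LTLPlanning.Sampler T B e (plan.path ph 1))
    (hnew : ∀ b ∈ LTLPlanning.targets B (plan.path ph 1) ph,
      ∀ (h : LTLPlanning.History N W Q) (k : ℕ), 1 ≤ k → k < plan.len ph →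
        plan.path ph k ∈ LTLPlanning.nodes T B e (plan.path ph 1) h →
        ∀ x, LTLPlanning.ptsStep T (plan.path ph k).1 x →
          some x ∈ (S.fnew b h (plan.path ph k)).support) :
    ∃ α : ℕ → ℝ,
      (∀ n, 1 ≤ n → 0 < α n ∧ α n ≤ 1 ∧
        IsLeast (S.successValues ph (plan.path ph) (plan.len ph) n) (α n)) ∧
      ∀ nmax : ℕ, plan.len ph < nmax →
        1 - Real.exp (-(∑ n ∈ Finset.Icc 1 nmax, α n) / 2 + (plan.len ph : ℝ)) ≤
            S.detectProb ph nmax (plan.path ph (plan.len ph)) ∧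
          S.detectProb ph nmax (plan.path ph (plan.len ph)) ≤ 1 := by
  have hne := LTLPlanning.targets_nonempty plan ph
  have hmin : ∀ n, ∃ a, IsLeast (S.successValues ph (plan.path ph) (plan.len ph) n) a := by
    intro n
    obtain ⟨b, hb⟩ := hne
    obtain ⟨h, hh⟩ := (S.run b (n - 1)).support_nonempty
    obtain ⟨a, ha, hle⟩ := Set.exists_min_image _ id
      (S.finite_successValues (q := plan.path ph) (K := plan.len ph) ph n) ⟨_, b, hb, h, hh, rfl⟩
    exact ⟨a, ha, hle⟩
  choose α hα using hmin
  refine ⟨α, fun n _ => ?_, fun nmax _ => ⟨?_, S.detectProb_le_one _ _ _⟩⟩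
  · obtain ⟨b, hb, h, -, hr⟩ := (hα n).1
    refine ⟨?_, hr.trans_le (S.successProb_le_one b h), hα n⟩
    rw [hr]
    exact S.successProb_pos (plan.len_pos ph) rfl (plan.step ph) b h (hnew b hb h)
  · exact S.le_detectProb hne (LTLPlanning.path_len_mem_goalSet plan ph) fun b hb =>
      S.le_toOuterMeasure_run (plan.len_pos ph) b
        (fun n h hh => (hα (n + 1)).2 ⟨b, hb, h, hh, rfl⟩) nmax
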